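/- Let $V$ be a vertex operator algebra over $\mathbb{C}$. For weak $V$-modules $W_1,W_2,W_3$, let $\mathrm{Hom}_V(W_1,W_2)$ be the vector space of $V$-module homomorphisms and let $\mathcal{V}^{W_3}_{W_1,W_2}$ be the vector space of (logarithmic) intertwining operators $\mathcal{Y}$ of type $\binom{W_3}{W_1\,W_2}$, that is, of linear maps $$\mathcal{Y}: W_1\otimes W_2\to W_3[\log x]\{x\},\qquad \mathcal{Y}(w_1,x)w_2=\sum_{h\in\mathbb{C}}\sum_{k\in\mathbb{N}} (w_1)_{h,k}w_2\,x^{-h-1}(\log x)^k,$$ that satisfy lower truncation (for all $h,w_1,w_2$ one has $(w_1)_{h+n,k}w_2=0$ for all sufficiently large $n\in\mathbb{N}$, independently of $k$), the Jacobi identity and the $L(-1)$-derivative property. Put $\mathrm{im}\,\mathcal{Y}=\mathrm{span}\{(w_1)_{h,k}w_2\}\subseteq W_3$. Let $\mathcal{C}$ be a full subcategory of the category of weak $V$-modules such that: * every object of $\mathcal{C}$ is a finitely generated grading-restricted generalized $V$-module; * $V$ and $0$ are objects of $\mathcal{C}$, and $\mathcal{C}$ is closed under submodules, quotients (in particular isomorphisms)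 and finite direct sums; * every pair of objects $W_1,W_2$ of $\mathcal{C}$ has a (chosen) tensor product $(W_1\boxtimes W_2,\mathcal{Y}_{W_1,W_2})$ in the sense of Huang–Lepowsky–Zhang: $W_1\boxtimes W_2$ is an object of $\mathcal{C}$, $\mathcal{Y}_{W_1,W_2}$ is an intertwining operator of type $\binom{W_1\boxtimes W_2}{W_1\,W_2}$, and for every object $W_3$ of $\mathcal{C}$ the map $\mathrm{Hom}_V(W_1\boxtimes W_2,W_3)\to\mathcal{V}^{W_3}_{W_1,W_2}$, $f\mapsto f\circ\mathcal{Y}_{W_1,W_2}$, is an isomorphism. For morphisms $f_1,f_2$ in $\mathcal{C}$ with $f_i:W_i\to U_i$, let $f_1\boxtimes f_2: W_1\boxtimes W_2\to U_1\boxtimes U_2$ be the unique homomorphism with $(f_1\boxtimes f_2)\circ\mathcal{Y}_{W_1,W_2}=\mathcal{Y}_{U_1,U_2}\circ(f_1\otimes f_2)$. Let $\mathrm{Ind}(\mathcal{C})$ be the full subcategory of weak $V$-modules that are isomorphic to direct limits, in the category of weak $V$-modules, of direct systems (over directed sets) of objects of $\mathcal{C}$. Assume further that $\mathrm{im}\,\mathcal{Y}$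 is an object of $\mathcal{C}$ for every intertwining operator $\mathcal{Y}$ of type $\binom{X}{W_1\,W_2}$ with $W_1,W_2$ in $\mathcal{C}$ and $X$ in $\mathrm{Ind}(\mathcal{C})$. For a weak $V$-module $X$ let $I_X$ be the directed set, under inclusion, of submodules $W\subseteq X$ that are objects of $\mathcal{C}$, with inclusion maps $i_W:W\to X$. For weak $V$-modules $X_1,X_2$ let $$X_1\widehat{\boxtimes}X_2=\varinjlim_{(W_1,W_2)\in I_{X_1}\times I_{X_2}} W_1\boxtimes W_2,$$ the transition maps being the tensor products of the inclusions, and let $\phi_{W_1,W_2}:W_1\boxtimes W_2\to X_1\widehat{\boxtimes}X_2$ be the canonical maps. **Theorem.** Let $X_1$ and $X_2$ be objects of $\mathrm{Ind}(\mathcal{C})$. Then $X_1\widehat{\boxtimes}X_2$ is an object of $\mathrm{Ind}(\mathcal{C})$, and there is an intertwining operator $\mathcal{Y}_{X_1,X_2}$ of type $\binom{X_1\widehat{\boxtimes}X_2}{X_1\,X_2}$ such that: 1. for all $W_1\in I_{X_1}$ and $W_2\in I_{X_2}$, $$\mathcal{Y}_{X_1,X_2}\circ(i_{W_1}\otimes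 i_{W_2})=\phi_{W_1,W_2}\circ\mathcal{Y}_{W_1,W_2};$$ 2. for every object $X_3$ of $\mathrm{Ind}(\mathcal{C})$, the linear map $$\mathrm{Hom}_V(X_1\widehat{\boxtimes}X_2,X_3)\to\mathcal{V}^{X_3}_{X_1,X_2},\qquad F\mapsto F\circ\mathcal{Y}_{X_1,X_2},$$ is an isomorphism. -/

import Mathlib

universe u

noncomputable section

namespace VertexInd

/-! ### The Jacobi identity in components -/

/-- The Jacobi identity
`x₀⁻¹δ((x₁-x₂)/x₀) A₃(v,x₁) Y(w₁,x₂) w₂ - x₀⁻¹δ((x₂-x₁)/(-x₀)) Y(w₁,x₂) A₂(v,x₁) w₂`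
`  = x₂⁻¹δ((x₁-x₀)/x₂) Y(A₁(v,x₀) w₁, x₂) w₂`,
where `Aⱼ(v,x) = ∑ₙ (Aⱼ n v) x^{-n-1}` and `Y(w,x) = ∑ₙ (Y n w) x^{-n-1}`, with `n` running
over `ℤ` in `Aⱼ` and over `K` (either `ℤ` or `ℂ`) in `Y`.
The displayed equation is the equality of the coefficients of `x₀^{-l-1} x₁^{-m-1} x₂^{-n-1}`
(delta functions and powers of binomials being expanded in nonnegative powers of the second
variable).  The sums are finite as soon as the operators satisfy lower truncation. -/
def JacobiIdentity {K V W₁ W₂ W₃ : Type*} [Ring K] [AddCommGroup V] [Module ℂ V]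
    [AddCommGroup W₁] [Module ℂ W₁] [AddCommGroup W₂] [Module ℂ W₂]
    [AddCommGroup W₃] [Module ℂ W₃]
    (A₁ : ℤ → V →ₗ[ℂ] W₁ →ₗ[ℂ] W₁) (A₂ : ℤ → V →ₗ[ℂ] W₂ →ₗ[ℂ] W₂)
    (A₃ : ℤ → V →ₗ[ℂ] W₃ →ₗ[ℂ] W₃) (Y : K → W₁ →ₗ[ℂ] W₂ →ₗ[ℂ] W₃)
    (v : V) (w₁ : W₁) (w₂ : W₂) : Prop :=
  ∀ (l m : ℤ) (n : K),
    (∑ᶠ i : ℕ, ((-1) ^ i * Ring.choose l i : ℤ) • A₃ (l + m - i) v (Y (n + i) w₁ w₂))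
      - (∑ᶠ i : ℕ, (l.negOnePow * (-1) ^ i * Ring.choose l i : ℤ) •
          Y (l + n - i) w₁ (A₂ (m + i) v w₂))
      = ∑ᶠ i : ℕ, (Ring.choose m i : ℤ) • Y (m + n - i) (A₁ (l + i) v w₁) w₂

/-! ### Vertex operator algebras and their modules -/

/-- A vertex operator algebra over `ℂ`; `mode n u v` is `uₙ v`, so that
`Y(u,x) v = ∑ₙ (mode n u v) x^{-n-1}`, and `L(n) = ω_{n+1}` for the conformal vector `ω`. -/
class VertexOperatorAlgebra (V : Type u) [AddCommGroup V] [Module ℂ V] where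
  mode : ℤ → V →ₗ[ℂ] V →ₗ[ℂ] V
  vac : V
  conf : V
  centralCharge : ℂ
  truncation : ∀ u v : V, ∃ N : ℤ, ∀ n, N ≤ n → mode n u v = 0
  vacuum : ∀ (n : ℤ) (v : V), mode n vac v = if n = -1 then v else 0
  creation : ∀ v : V, mode (-1) v vac = v ∧ ∀ n : ℤ, 0 ≤ n → mode n v vac = 0
  jacobi : ∀ u v w : V, JacobiIdentity mode mode mode mode u v w
  /-- the Virasoro relations for `L(n) = ω_{n+1}` -/
  virasoro : ∀ (m n : ℤ) (v : V),
    mode (m + 1) conf (mode (n + 1) conf v) - mode (n + 1) conf (mode (m + 1) conf v)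
      = ((m : ℂ) - n) • mode (m + n + 1) conf v
        + if m + n = 0 then (((m : ℂ) ^ 3 - m) / 12 * centralCharge) • v else 0
  /-- `Y(L(-1)v, x) = d/dx Y(v, x)` -/
  derivative : ∀ (n : ℤ) (v w : V), mode n (mode 0 conf v) w = (-(n : ℂ)) • mode (n - 1) v w
  /-- `V` is the direct sum of the `L(0)`-eigenspaces `V_(n)`, `n ∈ ℤ` -/
  grading : DirectSum.IsInternal fun n : ℤ => Module.End.eigenspace (mode 1 conf) (n : ℂ)
  finiteDimensional : ∀ n : ℤ,
    FiniteDimensional ℂ (Module.End.eigenspace (mode 1 conf) (n : ℂ))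
  lowerBounded : ∃ N : ℤ, ∀ n : ℤ, n < N → Module.End.eigenspace (mode 1 conf) (n : ℂ) = ⊥
  vac_weight : mode 1 conf vac = 0
  conf_weight : mode 1 conf conf = (2 : ℂ) • conf

/-- A weak module for the vertex operator algebra `V`. -/
structure WeakModule (V : Type u) [AddCommGroup V] [Module ℂ V] [VertexOperatorAlgebra V] where
  carrier : Type u
  [addCommGroup : AddCommGroup carrier]
  [module : Module ℂ carrier]
  mode : ℤ → V →ₗ[ℂ] carrier →ₗ[ℂ] carrier
  truncation : ∀ (v : V) (w : carrier), ∃ N : ℤ, ∀ n, N ≤ n → mode n v w = 0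
  vacuum : ∀ (n : ℤ) (w : carrier),
    mode n VertexOperatorAlgebra.vac w = if n = -1 then w else 0
  jacobi : ∀ (u v : V) (w : carrier),
    JacobiIdentity VertexOperatorAlgebra.mode mode mode mode u v w
  derivative : ∀ (n : ℤ) (v : V) (w : carrier),
    mode n (VertexOperatorAlgebra.mode 0 VertexOperatorAlgebra.conf v) w
      = (-(n : ℂ)) • mode (n - 1) v w

instance {V : Type u} [AddCommGroup V] [Module ℂ V] [VertexOperatorAlgebra V] :
    CoeSort (WeakModule V) (Type u) := ⟨WeakModule.carrier⟩

attribute [instance] WeakModule.addCommGroup WeakModule.module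

variable {V : Type u} [AddCommGroup V] [Module ℂ V] [VertexOperatorAlgebra V]

variable (V) in
/-- `V` as a module for itself. -/
def adjoint : WeakModule V where
  carrier := V
  mode := VertexOperatorAlgebra.mode
  truncation := VertexOperatorAlgebra.truncation
  vacuum := VertexOperatorAlgebra.vacuum
  jacobi := VertexOperatorAlgebra.jacobi
  derivative := VertexOperatorAlgebra.derivative

/-- The operator `L(n) = ω_{n+1}` on a weak module. -/
def WeakModule.L (M : WeakModule V) (n : ℤ) : Module.End ℂ M :=
  M.mode (n + 1) VertexOperatorAlgebra.conf

/-- The vector space `Hom_V(M, N)` of `V`-module homomorphisms. -/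
def Hom (M N : WeakModule V) : Submodule ℂ (M →ₗ[ℂ] N) where
  carrier := {f | ∀ (n : ℤ) (v : V) (w : M), f (M.mode n v w) = N.mode n v (f w)}
  add_mem' hf hg n v w := by simp [hf n v w, hg n v w]
  zero_mem' n v w := by simp
  smul_mem' c f hf n v w := by simp [hf n v w]

/-- A subspace stable under all modes, that is, a `V`-submodule. -/
def IsSub (M : WeakModule V) (S : Submodule ℂ M) : Prop :=
  ∀ (n : ℤ) (v : V), ∀ w ∈ S, M.mode n v w ∈ S

/-- A weak module is a generalized module if it is the direct sum of the generalized
eigenspaces of `L(0)`. -/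
def IsGeneralized (M : WeakModule V) : Prop :=
  DirectSum.IsInternal fun h : ℂ => Module.End.maxGenEigenspace (M.L 0) h

/-- Grading-restricted generalized modules. -/
structure IsGradingRestricted (M : WeakModule V) : Prop where
  generalized : IsGeneralized M
  finiteDimensional : ∀ h : ℂ, FiniteDimensional ℂ (Module.End.maxGenEigenspace (M.L 0) h)
  lowerBounded : ∀ h : ℂ, ∃ N : ℤ, ∀ n : ℤ, n ≤ N →
    Module.End.maxGenEigenspace (M.L 0) (h + n) = ⊥

/-- Some finite subset is contained in no proper `V`-submodule. -/
def IsFinitelyGenerated (M : WeakModule V) : Prop :=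
  ∃ s : Finset M, ∀ S : Submodule ℂ M, IsSub M S → (∀ w ∈ s, w ∈ S) → S = ⊤

/-! ### Linearity lemmas for the Jacobi identity -/

section finite

lemma support_finite {M : Type*} [AddCommGroup M] {f : ℕ → M}
    (h : ∃ N : ℤ, ∀ i : ℕ, N ≤ i → f i = 0) : (Function.support f).Finite := by
  obtain ⟨N, hN⟩ := h
  refine (Set.finite_lt_nat N.toNat).subset fun i hi => ?_
  by_contra hc
  refine hi (hN i ?_)
  have hc' : ¬ i < N.toNat := hc
  omega

variable {K U W₁ W₂ W₃ W₁' W₂' W₃' : Type*} [Ring K] [AddCommGroup U] [Module ℂ U]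
  [AddCommGroup W₁] [Module ℂ W₁] [AddCommGroup W₂] [Module ℂ W₂]
  [AddCommGroup W₃] [Module ℂ W₃] [AddCommGroup W₁'] [Module ℂ W₁'] [AddCommGroup W₂']
  [Module ℂ W₂'] [AddCommGroup W₃'] [Module ℂ W₃']

/-- Lower truncation for the three sums in the Jacobi identity. -/
def Trunc (A₁ : ℤ → U →ₗ[ℂ] W₁ →ₗ[ℂ] W₁) (A₂ : ℤ → U →ₗ[ℂ] W₂ →ₗ[ℂ] W₂)
    (Y : K → W₁ →ₗ[ℂ] W₂ →ₗ[ℂ] W₃) (v : U) (w₁ : W₁) (w₂ : W₂) : Prop :=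
  (∃ N : ℤ, ∀ n, N ≤ n → A₁ n v w₁ = 0) ∧ (∃ N : ℤ, ∀ n, N ≤ n → A₂ n v w₂ = 0) ∧
    ∀ h : K, ∃ N : ℤ, ∀ n : ℕ, N ≤ n → Y (h + n) w₁ w₂ = 0

variable {A₁ : ℤ → U →ₗ[ℂ] W₁ →ₗ[ℂ] W₁} {A₂ : ℤ → U →ₗ[ℂ] W₂ →ₗ[ℂ] W₂}
  {A₃ : ℤ → U →ₗ[ℂ] W₃ →ₗ[ℂ] W₃} {Y : K → W₁ →ₗ[ℂ] W₂ →ₗ[ℂ] W₃}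
  {v : U} {w₁ : W₁} {w₂ : W₂}

lemma Trunc.fin₁ (h : Trunc A₁ A₂ Y v w₁ w₂) (c : ℕ → ℤ) (k : ℕ → ℤ) (n : K) :
    (Function.support fun i : ℕ => c i • A₃ (k i) v (Y (n + i) w₁ w₂)).Finite := by
  obtain ⟨N, hN⟩ := h.2.2 n
  exact support_finite ⟨N, fun i hi => by simp [hN i hi]⟩

lemma Trunc.fin₂ (h : Trunc A₁ A₂ Y v w₁ w₂) (c : ℕ → ℤ) (k : ℕ → K) (m : ℤ) :
    (Function.support fun i : ℕ => c i • Y (k i) w₁ (A₂ (m + i) v w₂)).Finite := by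
  obtain ⟨N, hN⟩ := h.2.1
  exact support_finite ⟨N - m, fun i hi => by simp [hN (m + i) (by omega)]⟩

lemma Trunc.fin₃ (h : Trunc A₁ A₂ Y v w₁ w₂) (c : ℕ → ℤ) (k : ℕ → K) (l : ℤ) :
    (Function.support fun i : ℕ => c i • Y (k i) (A₁ (l + i) v w₁) w₂).Finite := by
  obtain ⟨N, hN⟩ := h.1
  exact support_finite ⟨N - l, fun i hi => by simp [hN (l + i) (by omega)]⟩

/-- If a second system of operators is obtained from a first one by a linear map on the target,
the Jacobi identity is inherited. -/
lemma JacobiIdentity.map {A₁' : ℤ → U →ₗ[ℂ] W₁' →ₗ[ℂ] W₁'} {A₂' : ℤ → U →ₗ[ℂ] W₂' →ₗ[ℂ] W₂'}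
    {A₃' : ℤ → U →ₗ[ℂ] W₃' →ₗ[ℂ] W₃'} {Y' : K → W₁' →ₗ[ℂ] W₂' →ₗ[ℂ] W₃'}
    {w₁' : W₁'} {w₂' : W₂'} (f : W₃ →ₗ[ℂ] W₃')
    (h₁ : ∀ k n, Y' k w₁' (A₂' n v w₂') = f (Y k w₁ (A₂ n v w₂)))
    (h₂ : ∀ k n, Y' k (A₁' n v w₁') w₂' = f (Y k (A₁ n v w₁) w₂))
    (h₃ : ∀ k n, A₃' n v (Y' k w₁' w₂') = f (A₃ n v (Y k w₁ w₂)))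
    (ht : Trunc A₁ A₂ Y v w₁ w₂) (hJ : JacobiIdentity A₁ A₂ A₃ Y v w₁ w₂) :
    JacobiIdentity A₁' A₂' A₃' Y' v w₁' w₂' := by
  intro l m n
  have h := congrArg f (hJ l m n)
  have key : ∀ g : ℕ → W₃, (Function.support g).Finite → f (∑ᶠ i, g i) = ∑ᶠ i, f (g i) :=
    fun g hg => map_finsum f hg
  rw [map_sub, key _ (ht.fin₁ _ _ _), key _ (ht.fin₂ _ _ _), key _ (ht.fin₃ _ _ _)] at h
  simpa only [h₁, h₂, h₃, map_zsmul] using h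

/-- Conversely, the Jacobi identity may be tested after an injective (family of) maps. -/
lemma JacobiIdentity.comap {ι : Type*} {T : ι → Type*} [∀ t, AddCommGroup (T t)]
    [∀ t, Module ℂ (T t)] (f : ∀ t, W₃ →ₗ[ℂ] T t) (hf : ∀ x y, (∀ t, f t x = f t y) → x = y)
    (ht : Trunc A₁ A₂ Y v w₁ w₂)
    (hJ : ∀ t, ∀ (l m : ℤ) (n : K),
      (∑ᶠ i : ℕ, ((-1) ^ i * Ring.choose l i : ℤ) • f t (A₃ (l + m - i) v (Y (n + i) w₁ w₂)))
      - (∑ᶠ i : ℕ, (l.negOnePow * (-1) ^ i * Ring.choose l i : ℤ) •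
          f t (Y (l + n - i) w₁ (A₂ (m + i) v w₂)))
      = ∑ᶠ i : ℕ, (Ring.choose m i : ℤ) • f t (Y (m + n - i) (A₁ (l + i) v w₁) w₂)) :
    JacobiIdentity A₁ A₂ A₃ Y v w₁ w₂ := by
  intro l m n
  refine hf _ _ fun t => ?_
  have key : ∀ g : ℕ → W₃, (Function.support g).Finite → f t (∑ᶠ i, g i) = ∑ᶠ i, f t (g i) :=
    fun g hg => map_finsum (f t) hg
  rw [map_sub, key _ (ht.fin₁ _ _ _), key _ (ht.fin₂ _ _ _), key _ (ht.fin₃ _ _ _)]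
  simpa only [map_zsmul] using hJ t l m n

lemma JacobiIdentity.add_right {w₂' : W₂} (ht : Trunc A₁ A₂ Y v w₁ w₂)
    (ht' : Trunc A₁ A₂ Y v w₁ w₂') (hJ : JacobiIdentity A₁ A₂ A₃ Y v w₁ w₂)
    (hJ' : JacobiIdentity A₁ A₂ A₃ Y v w₁ w₂') :
    JacobiIdentity A₁ A₂ A₃ Y v w₁ (w₂ + w₂') := by
  intro l m n
  simp only [map_add, smul_add]
  rw [finsum_add_distrib (ht.fin₁ _ _ _) (ht'.fin₁ _ _ _),
    finsum_add_distrib (ht.fin₂ _ _ _) (ht'.fin₂ _ _ _),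
    finsum_add_distrib (ht.fin₃ _ _ _) (ht'.fin₃ _ _ _), ← hJ l m n, ← hJ' l m n]
  abel

lemma JacobiIdentity.add_op {Y' : K → W₁ →ₗ[ℂ] W₂ →ₗ[ℂ] W₃} (ht : Trunc A₁ A₂ Y v w₁ w₂)
    (ht' : Trunc A₁ A₂ Y' v w₁ w₂) (hJ : JacobiIdentity A₁ A₂ A₃ Y v w₁ w₂)
    (hJ' : JacobiIdentity A₁ A₂ A₃ Y' v w₁ w₂) :
    JacobiIdentity A₁ A₂ A₃ (fun k => Y k + Y' k) v w₁ w₂ := by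
  intro l m n
  simp only [LinearMap.add_apply, map_add, smul_add]
  rw [finsum_add_distrib (ht.fin₁ _ _ _) (ht'.fin₁ _ _ _),
    finsum_add_distrib (ht.fin₂ _ _ _) (ht'.fin₂ _ _ _),
    finsum_add_distrib (ht.fin₃ _ _ _) (ht'.fin₃ _ _ _), ← hJ l m n, ← hJ' l m n]
  abel

end finite

lemma WeakModule.trunc (M : WeakModule V) (u v : V) (w : M) :
    Trunc VertexOperatorAlgebra.mode M.mode M.mode u v w := by
  refine ⟨VertexOperatorAlgebra.truncation u v, M.truncation u w, fun h => ?_⟩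
  obtain ⟨N, hN⟩ := M.truncation v w
  exact ⟨N - h, fun n hn => hN _ (by omega)⟩

/-! ### Submodules, direct sums, direct limits of weak modules -/

/-- A `V`-submodule as a weak module. -/
def WeakModule.restrict (M : WeakModule V) (S : Submodule ℂ M) (hS : IsSub M S) :
    WeakModule V where
  carrier := S
  mode n :=
    { toFun := fun v => (M.mode n v).restrict (hS n v)
      map_add' := fun _ _ => by ext; simp
      map_smul' := fun _ _ => by ext; simp }
  truncation v w := by
    obtain ⟨N, hN⟩ := M.truncation v w
    exact ⟨N, fun n hn => Subtype.ext (hN n hn)⟩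
  vacuum n w := by
    apply Subtype.ext
    change M.mode n _ (w : M) = _
    rw [M.vacuum]
    split_ifs <;> rfl
  jacobi u v w := by
    refine JacobiIdentity.comap (ι := Unit) (fun _ => S.subtype)
      (fun x y h => Subtype.ext (h ())) ?_ fun _ l m n => M.jacobi u v w l m n
    obtain ⟨h₁, ⟨N, hN⟩, h₃⟩ := M.trunc u v w
    refine ⟨h₁, ⟨N, fun n hn => Subtype.ext (hN n hn)⟩, fun h => ?_⟩
    obtain ⟨N, hN⟩ := h₃ h
    exact ⟨N, fun n hn => Subtype.ext (hN n hn)⟩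
  derivative n v w := Subtype.ext (M.derivative n v w)

/-- The direct sum of two weak modules. -/
def WeakModule.prod (M N : WeakModule V) : WeakModule V where
  carrier := M × N
  mode n :=
    { toFun := fun v => (M.mode n v).prodMap (N.mode n v)
      map_add' := fun _ _ => by ext <;> simp
      map_smul' := fun _ _ => by ext <;> simp }
  truncation v w := by
    obtain ⟨A, hA⟩ := M.truncation v w.1
    obtain ⟨B, hB⟩ := N.truncation v w.2
    exact ⟨max A B, fun n hn => Prod.ext (hA n (le_trans (le_max_left _ _) hn))
      (hB n (le_trans (le_max_right _ _) hn))⟩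
  vacuum n w := by
    apply Prod.ext
    · change M.mode n _ w.1 = _
      rw [M.vacuum]; split_ifs <;> rfl
    · change N.mode n _ w.2 = _
      rw [N.vacuum]; split_ifs <;> rfl
  jacobi u v w := by
    refine JacobiIdentity.comap (ι := Bool) (T := fun b => (bif b then M else N : WeakModule V))
      (fun b => match b with
        | true => LinearMap.fst ℂ M N
        | false => LinearMap.snd ℂ M N)
      (fun x y h => Prod.ext (h true) (h false)) ?_ fun b l m n => ?_
    · obtain ⟨h₁, ⟨A, hA⟩, hA'⟩ := M.trunc u v w.1
      obtain ⟨_, ⟨B, hB⟩, hB'⟩ := N.trunc u v w.2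
      refine ⟨h₁, ⟨max A B, fun n hn => Prod.ext (hA n (le_trans (le_max_left _ _) hn))
        (hB n (le_trans (le_max_right _ _) hn))⟩, fun h => ?_⟩
      obtain ⟨A, hA⟩ := hA' h
      obtain ⟨B, hB⟩ := hB' h
      exact ⟨max A B, fun n hn => Prod.ext (hA n (le_trans (le_max_left _ _) hn))
        (hB n (le_trans (le_max_right _ _) hn))⟩
    · cases b
      · exact N.jacobi u v w.2 l m n
      · exact M.jacobi u v w.1 l m n
  derivative n v w := Prod.ext (M.derivative n v w.1) (N.derivative n v w.2)

section DirectLimit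

open scoped Classical in
/-- The underlying vector space of a direct limit. -/
abbrev LimitSpace {I : Type u} [Preorder I] (α : I → WeakModule V)
    (f : ∀ i j, i ≤ j → Hom (α i) (α j)) : Type u :=
  Module.DirectLimit (fun i => α i) (fun i j h => (f i j h : α i →ₗ[ℂ] α j))

variable {I : Type u} [Preorder I] (α : I → WeakModule V) (f : ∀ i j, i ≤ j → Hom (α i) (α j))

open scoped Classical in
/-- The linear map from a member of the system to the direct limit. -/
def toLimit (i : I) : α i →ₗ[ℂ] LimitSpace α f :=
  Module.DirectLimit.of ℂ I (fun i => α i) (fun i j h => (f i j h : α i →ₗ[ℂ] α j)) i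

lemma limit_induction {p : LimitSpace α f → Prop} (h₁ : ∀ i x, p (toLimit α f i x)) (h₀ : p 0)
    (h₂ : ∀ x y, p x → p y → p (x + y)) (x : LimitSpace α f) : p x := by
  classical
  refine Quotient.inductionOn' x fun z => DirectSum.induction_on z h₀ (fun i x => ?_)
    (fun a b ha hb => h₂ _ _ ha hb)
  have := h₁ i x
  rw [toLimit, ← Module.DirectLimit.quotMk_of] at this
  exact this

open scoped Classical in
/-- The mode `vₙ` on the direct limit, induced by the modes on the members of the system. -/
def limitMode (n : ℤ) : V →ₗ[ℂ] LimitSpace α f →ₗ[ℂ] LimitSpace α f where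
  toFun v := Module.DirectLimit.map (fun i => (α i).mode n v) fun i j h => by
    ext x; exact ((f i j h).2 n v x).symm
  map_add' v w := by
    apply Module.DirectLimit.hom_ext; intro i; ext x; simp
  map_smul' c v := by
    apply Module.DirectLimit.hom_ext; intro i; ext x; simp

lemma limitMode_toLimit (n : ℤ) (v : V) (i : I) (x : α i) :
    limitMode α f n v (toLimit α f i x) = toLimit α f i ((α i).mode n v x) := by
  simp [limitMode, toLimit]

lemma limitMode_truncation (v : V) (w : LimitSpace α f) :
    ∃ N : ℤ, ∀ n, N ≤ n → limitMode α f n v w = 0 := by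
  refine limit_induction α f (p := fun w => ∃ N : ℤ, ∀ n, N ≤ n → limitMode α f n v w = 0)
    (fun i x => ?_) ⟨0, by simp⟩ ?_ w
  · obtain ⟨N, hN⟩ := (α i).truncation v x
    exact ⟨N, fun n hn => by rw [limitMode_toLimit, hN n hn, map_zero]⟩
  · rintro x y ⟨A, hA⟩ ⟨B, hB⟩
    exact ⟨max A B, fun n hn => by
      rw [map_add, hA n (le_trans (le_max_left _ _) hn), hB n (le_trans (le_max_right _ _) hn),
        add_zero]⟩

lemma limitMode_trunc (u v : V) (w : LimitSpace α f) :
    Trunc VertexOperatorAlgebra.mode (limitMode α f) (limitMode α f) u v w := by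
  refine ⟨VertexOperatorAlgebra.truncation u v, limitMode_truncation α f u w, fun h => ?_⟩
  obtain ⟨N, hN⟩ := limitMode_truncation α f v w
  exact ⟨N - h, fun n hn => hN _ (by omega)⟩

/-- The direct limit of a direct system of weak modules. -/
def directLimit : WeakModule V where
  carrier := LimitSpace α f
  mode := limitMode α f
  truncation := limitMode_truncation α f
  vacuum n w := by
    refine limit_induction α f (p := fun w => limitMode α f n VertexOperatorAlgebra.vac w
      = if n = -1 then w else 0) (fun i x => ?_) (by simp) (fun x y hx hy => ?_) w
    · rw [limitMode_toLimit, (α i).vacuum]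
      split_ifs <;> simp
    · rw [map_add, hx, hy]
      split_ifs <;> simp
  jacobi u v w := by
    refine limit_induction α f (p := fun w => JacobiIdentity VertexOperatorAlgebra.mode
      (limitMode α f) (limitMode α f) (limitMode α f) u v w) (fun i x => ?_) ?_
      (fun x y hx hy => hx.add_right (limitMode_trunc α f u v x) (limitMode_trunc α f u v y) hy) w
    · refine ((α i).jacobi u v x).map (toLimit α f i) ?_ ?_ ?_ ((α i).trunc u v x) <;>
      · intro k n
        simp only [limitMode_toLimit]
    · intro l m n
      simp
  derivative n v w := by
    refine limit_induction α f (p := fun w => limitMode α f n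
      (VertexOperatorAlgebra.mode 0 VertexOperatorAlgebra.conf v) w
      = (-(n : ℂ)) • limitMode α f (n - 1) v w) (fun i x => ?_) (by simp) (fun x y hx hy => ?_) w
    · rw [limitMode_toLimit, limitMode_toLimit, (α i).derivative, map_smul]
    · rw [map_add, hx, hy, map_add, smul_add]

/-- The homomorphism `φᵢ` from a member of the system to the direct limit. -/
def limitInj (i : I) : Hom (α i) (directLimit α f) :=
  ⟨toLimit α f i, fun n v w => (limitMode_toLimit α f n v i w).symm⟩

end DirectLimit

/-! ### Intertwining operators -/

/-- The vector space of (logarithmic) intertwining operators of type `(W₃ / W₁ W₂)`.  An element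
`Y` stands for the operator `Y(w₁,x)w₂ = ∑_{h ∈ ℂ} ∑_{k ∈ ℕ} (Y h k w₁ w₂) x^{-h-1} (log x)^k`
with values in `W₃[log x]{x}`: every power of `x` has a polynomial in `log x` as coefficient
(first condition).  The other conditions are lower truncation, the Jacobi identity and the
`L(-1)`-derivative property `Y(L(-1)w₁, x) = d/dx Y(w₁, x)`. -/
def Intertwiner (W₁ W₂ W₃ : WeakModule V) :
    Submodule ℂ (ℂ → ℕ → W₁ →ₗ[ℂ] W₂ →ₗ[ℂ] W₃) where
  carrier := {Y |
    (∀ (w₁ : W₁) (w₂ : W₂) (h : ℂ), ∃ B : ℕ, ∀ k, B ≤ k → Y h k w₁ w₂ = 0) ∧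
    (∀ (w₁ : W₁) (w₂ : W₂) (h : ℂ), ∃ N : ℕ, ∀ n : ℕ, N ≤ n → ∀ k, Y (h + n) k w₁ w₂ = 0) ∧
    (∀ (v : V) (w₁ : W₁) (w₂ : W₂) (k : ℕ),
      JacobiIdentity W₁.mode W₂.mode W₃.mode (fun h => Y h k) v w₁ w₂) ∧
    (∀ (w₁ : W₁) (w₂ : W₂) (h : ℂ) (k : ℕ),
      Y h k (W₁.L (-1) w₁) w₂
        = (-h) • Y (h - 1) k w₁ w₂ + ((k : ℂ) + 1) • Y (h - 1) (k + 1) w₁ w₂)}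
  add_mem' := by
    rintro Y Z ⟨a, b, c, d⟩ ⟨a', b', c', d'⟩
    refine ⟨fun w₁ w₂ h => ?_, fun w₁ w₂ h => ?_, fun v w₁ w₂ k => ?_, fun w₁ w₂ h k => ?_⟩
    · obtain ⟨A, hA⟩ := a w₁ w₂ h
      obtain ⟨B, hB⟩ := a' w₁ w₂ h
      exact ⟨max A B, fun k hk => by
        simp [hA k (le_trans (le_max_left _ _) hk), hB k (le_trans (le_max_right _ _) hk)]⟩
    · obtain ⟨A, hA⟩ := b w₁ w₂ h
      obtain ⟨B, hB⟩ := b' w₁ w₂ h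
      exact ⟨max A B, fun n hn k => by
        simp [hA n (le_trans (le_max_left _ _) hn) k, hB n (le_trans (le_max_right _ _) hn) k]⟩
    · refine (c v w₁ w₂ k).add_op ⟨W₁.truncation v w₁, W₂.truncation v w₂, fun h => ?_⟩
        ⟨W₁.truncation v w₁, W₂.truncation v w₂, fun h => ?_⟩ (c' v w₁ w₂ k)
      · obtain ⟨N, hN⟩ := b w₁ w₂ h
        exact ⟨N, fun n hn => hN n (by omega) k⟩
      · obtain ⟨N, hN⟩ := b' w₁ w₂ h
        exact ⟨N, fun n hn => hN n (by omega) k⟩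
    · simp only [Pi.add_apply, LinearMap.add_apply, d w₁ w₂ h k, d' w₁ w₂ h k, smul_add]
      abel
  zero_mem' := by
    refine ⟨fun w₁ w₂ h => ⟨0, by simp⟩, fun w₁ w₂ h => ⟨0, by simp⟩,
      fun v w₁ w₂ k l m n => by simp, fun w₁ w₂ h k => by simp⟩
  smul_mem' := by
    rintro t Y ⟨a, b, c, d⟩
    refine ⟨fun w₁ w₂ h => ?_, fun w₁ w₂ h => ?_, fun v w₁ w₂ k => ?_, fun w₁ w₂ h k => ?_⟩
    · obtain ⟨A, hA⟩ := a w₁ w₂ h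
      exact ⟨A, fun k hk => by simp [hA k hk]⟩
    · obtain ⟨A, hA⟩ := b w₁ w₂ h
      exact ⟨A, fun n hn k => by simp [hA n hn k]⟩
    · refine (c v w₁ w₂ k).map (LinearMap.lsmul ℂ W₃ t) ?_ ?_ ?_
        ⟨W₁.truncation v w₁, W₂.truncation v w₂, fun h => ?_⟩
      · intros; simp
      · intros; simp
      · intros; simp
      · obtain ⟨N, hN⟩ := b w₁ w₂ h
        exact ⟨N, fun n hn => hN n (by omega) k⟩
    · simp only [Pi.smul_apply, LinearMap.smul_apply, d w₁ w₂ h k, smul_add, smul_comm t]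

lemma Intertwiner.trunc {W₁ W₂ W₃ : WeakModule V} (Y : Intertwiner W₁ W₂ W₃) (v : V) (w₁ : W₁)
    (w₂ : W₂) (k : ℕ) : Trunc W₁.mode W₂.mode (fun h => Y.1 h k) v w₁ w₂ := by
  refine ⟨W₁.truncation v w₁, W₂.truncation v w₂, fun h => ?_⟩
  obtain ⟨N, hN⟩ := Y.2.2.1 w₁ w₂ h
  exact ⟨N, fun n hn => hN n (by omega) k⟩

/-- The linear map `Hom_V(T, W₃) → 𝒱^{W₃}_{W₁,W₂}`, `F ↦ F ∘ Y`, for an intertwining operator `Y`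
of type `(T / W₁ W₂)`. -/
def compIntertwiner {W₁ W₂ T : WeakModule V} (Y : Intertwiner W₁ W₂ T) (W₃ : WeakModule V) :
    Hom T W₃ →ₗ[ℂ] Intertwiner W₁ W₂ W₃ where
  toFun F := ⟨fun h k => (Y.1 h k).compr₂ F.1, by
    refine ⟨fun w₁ w₂ h => ?_, fun w₁ w₂ h => ?_, fun v w₁ w₂ k => ?_, fun w₁ w₂ h k => ?_⟩
    · obtain ⟨A, hA⟩ := Y.2.1 w₁ w₂ h
      exact ⟨A, fun k hk => by simp [hA k hk]⟩
    · obtain ⟨A, hA⟩ := Y.2.2.1 w₁ w₂ h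
      exact ⟨A, fun n hn k => by simp [hA n hn k]⟩
    · refine (Y.2.2.2.1 v w₁ w₂ k).map F.1 ?_ ?_ ?_ (Intertwiner.trunc Y v w₁ w₂ k)
      · intros; simp
      · intros; simp
      · intro h n
        exact (F.2 n v _).symm
    · simp [Y.2.2.2.2 w₁ w₂ h k]⟩
  map_add' F G := by ext; simp
  map_smul' c F := by ext; simp

/-- The intertwining operator `Y ∘ (f₁ ⊗ f₂)`. -/
def precomp {W₁ W₂ U₁ U₂ W₃ : WeakModule V} (Y : Intertwiner U₁ U₂ W₃) (f₁ : Hom W₁ U₁)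
    (f₂ : Hom W₂ U₂) : Intertwiner W₁ W₂ W₃ :=
  ⟨fun h k => (Y.1 h k).compl₁₂ f₁.1 f₂.1, by
    refine ⟨fun w₁ w₂ h => Y.2.1 _ _ h, fun w₁ w₂ h => Y.2.2.1 _ _ h, fun v w₁ w₂ k => ?_,
      fun w₁ w₂ h k => ?_⟩
    · refine (Y.2.2.2.1 v (f₁.1 w₁) (f₂.1 w₂) k).map LinearMap.id ?_ ?_ ?_ (Intertwiner.trunc Y v _ _ k)
      · intro h n
        simp [f₂.2 n v w₂]
      · intro h n
        simp [f₁.2 n v w₁]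
      · intros; simp
    · have := Y.2.2.2.2 (f₁.1 w₁) (f₂.1 w₂) h k
      rw [LinearMap.compl₁₂_apply, WeakModule.L, f₁.2]
      exact this⟩

/-- The image `im Y`: the span of all coefficients `(w₁)_{h,k} w₂`. -/
def image {W₁ W₂ W₃ : WeakModule V} (Y : Intertwiner W₁ W₂ W₃) : Submodule ℂ W₃ :=
  Submodule.span ℂ {x | ∃ h k w₁ w₂, x = Y.1 h k w₁ w₂}

lemma image_isSub {W₁ W₂ W₃ : WeakModule V} (Y : Intertwiner W₁ W₂ W₃) :
    IsSub W₃ (image Y) := by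
  intro n v w hw
  have hmem : ∀ h k w₁ w₂, Y.1 h k w₁ w₂ ∈ image Y :=
    fun h k w₁ w₂ => Submodule.subset_span ⟨h, k, w₁, w₂, rfl⟩
  suffices h : image Y ≤ (image Y).comap (W₃.mode n v) from h hw
  refine Submodule.span_le.2 ?_
  rintro x ⟨h, k, w₁, w₂, rfl⟩
  change W₃.mode n v (Y.1 h k w₁ w₂) ∈ image Y
  have hJ := Y.2.2.2.1 v w₁ w₂ k 0 n h
  rw [finsum_eq_single _ 0 (fun i hi => by
      rw [Ring.choose_zero_pos ℤ (Nat.pos_of_ne_zero hi), mul_zero, zero_smul]),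
    finsum_eq_single _ 0 (fun i hi => by
      rw [Ring.choose_zero_pos ℤ (Nat.pos_of_ne_zero hi), mul_zero, zero_smul])] at hJ
  simp only [pow_zero, Ring.choose_zero_right, mul_one, one_smul, Nat.cast_zero, zero_add,
    sub_zero, add_zero, Int.negOnePow_zero, Units.val_one, Int.cast_zero] at hJ
  rw [sub_eq_iff_eq_add.1 hJ]
  exact Submodule.add_mem _ (finsum_induction (· ∈ image Y) (Submodule.zero_mem _)
    (fun x y => Submodule.add_mem _) fun i => zsmul_mem (hmem _ _ _ _) _) (hmem _ _ _ _)

/-- `im Y` as a weak module. -/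
def imageModule {W₁ W₂ W₃ : WeakModule V} (Y : Intertwiner W₁ W₂ W₃) : WeakModule V :=
  W₃.restrict (image Y) (image_isSub Y)

/-- Universal property of the tensor product within the full subcategory of weak modules with
object class `D`: `T` is an object of `D`, and composition with `Y` is a linear isomorphism
`Hom_V(T, W₃) ≅ 𝒱^{W₃}_{W₁,W₂}` for every object `W₃` of `D`. -/
structure IsIntertwiningTensorProduct (D : WeakModule V → Prop) {W₁ W₂ T : WeakModule V}
    (Y : Intertwiner W₁ W₂ T) : Prop where
  mem : D T
  bijective : ∀ W₃ : WeakModule V, D W₃ → Function.Bijective (compIntertwiner Y W₃)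

/-! ### The category `C`, its tensor product, and its direct limit completion -/

/-- Standing conditions on (the object class of) a full subcategory `C` of weak modules. -/
structure IsAdmissible (C : WeakModule V → Prop) : Prop where
  gradingRestricted : ∀ M, C M → IsGradingRestricted M
  finitelyGenerated : ∀ M, C M → IsFinitelyGenerated M
  zero : ∀ M : WeakModule V, Subsingleton M → C M
  sub : ∀ (M N : WeakModule V) (f : Hom M N), Function.Injective f.1 → C N → C M
  quot : ∀ (M N : WeakModule V) (f : Hom M N), Function.Surjective f.1 → C M → C N
  sum : ∀ M N : WeakModule V, C M → C N → C (M.prod N)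

/-- The choice of a tensor product `(W₁ ⊠ W₂, Y_{W₁,W₂})` for all pairs of objects of `C`. -/
structure TensorStructure (C : WeakModule V → Prop) where
  obj : {M // C M} → {M // C M} → WeakModule V
  op : ∀ W₁ W₂ : {M // C M}, Intertwiner W₁.1 W₂.1 (obj W₁ W₂)
  isTensorProduct : ∀ W₁ W₂ : {M // C M}, IsIntertwiningTensorProduct C (op W₁ W₂)

/-- The tensor product `f₁ ⊠ f₂` of morphisms: the unique homomorphism with
`(f₁ ⊠ f₂) ∘ Y_{W₁,W₂} = Y_{U₁,U₂} ∘ (f₁ ⊗ f₂)`. -/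
def TensorStructure.map {C : WeakModule V → Prop} (T : TensorStructure C)
    {W₁ W₂ U₁ U₂ : {M // C M}} (f₁ : Hom W₁.1 U₁.1) (f₂ : Hom W₂.1 U₂.1) :
    Hom (T.obj W₁ W₂) (T.obj U₁ U₂) :=
  (((T.isTensorProduct W₁ W₂).bijective (T.obj U₁ U₂) (T.isTensorProduct U₁ U₂).mem).2
    (precomp (T.op U₁ U₂) f₁ f₂)).choose

/-- The direct limit completion `Ind(C)`: weak modules isomorphic to the direct limit of a direct
system, indexed by a directed set, of objects of `C`. -/
def Ind (C : WeakModule V → Prop) (X : WeakModule V) : Prop :=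
  ∃ (I : Type u) (_ : Preorder I) (_ : Nonempty I) (_ : IsDirectedOrder I)
    (α : I → WeakModule V) (f : ∀ i j, i ≤ j → Hom (α i) (α j)),
    (∀ i, C (α i)) ∧
    (∀ i, (f i i le_rfl).1 = LinearMap.id) ∧
    (∀ i j k (hij : i ≤ j) (hjk : j ≤ k),
      (f j k hjk).1 ∘ₗ (f i j hij).1 = (f i k (hij.trans hjk)).1) ∧
    ∃ F : Hom (directLimit α f) X, Function.Bijective F.1

/-- The poset `I_X` of `V`-submodules of `X` that are objects of `C`. -/
abbrev CSub (C : WeakModule V → Prop) (X : WeakModule V) : Type u :=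
  {S : Submodule ℂ X // ∃ h : IsSub X S, C (X.restrict S h)}

/-- A member of `I_X` as an object of `C`. -/
def CSub.toObj {C : WeakModule V → Prop} {X : WeakModule V} (S : CSub C X) : {M // C M} :=
  ⟨X.restrict S.1 S.2.fst, S.2.snd⟩

/-- The inclusion `i_W : W → X`. -/
def CSub.incl {C : WeakModule V → Prop} {X : WeakModule V} (S : CSub C X) : Hom S.toObj.1 X :=
  ⟨S.1.subtype, fun _ _ _ => rfl⟩

/-- The inclusion `W → W'` for `W ⊆ W'` in `I_X`. -/
def CSub.inclLE {C : WeakModule V → Prop} {X : WeakModule V} {S S' : CSub C X} (h : S ≤ S') :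
    Hom S.toObj.1 S'.toObj.1 :=
  ⟨Submodule.inclusion h, fun _ _ _ => rfl⟩

/-- `X₁ ⊠̂ X₂`: the direct limit over `I_{X₁} × I_{X₂}` of the modules `W₁ ⊠ W₂`. -/
def TensorStructure.hat {C : WeakModule V → Prop} (T : TensorStructure C)
    (X₁ X₂ : WeakModule V) : WeakModule V :=
  directLimit (I := CSub C X₁ × CSub C X₂) (fun p => T.obj p.1.toObj p.2.toObj)
    fun p q (h : p ≤ q) => T.map (CSub.inclLE (Prod.le_def.1 h).1) (CSub.inclLE (Prod.le_def.1 h).2)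

/-- The canonical homomorphism `φ_{W₁,W₂} : W₁ ⊠ W₂ → X₁ ⊠̂ X₂`. -/
def TensorStructure.phi {C : WeakModule V → Prop} (T : TensorStructure C)
    {X₁ X₂ : WeakModule V} (W₁ : CSub C X₁) (W₂ : CSub C X₂) :
    Hom (T.obj W₁.toObj W₂.toObj) (T.hat X₁ X₂) :=
  limitInj (I := CSub C X₁ × CSub C X₂) (fun p => T.obj p.1.toObj p.2.toObj)
    (fun p q (h : p ≤ q) => T.map (CSub.inclLE (Prod.le_def.1 h).1) (CSub.inclLE (Prod.le_def.1 h).2)) (W₁, W₂)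

end VertexInd

end

open VertexInd

/-! An object $X$ of $\mathrm{Ind}(\mathcal{C})$ is the directed union of the members of $I_X$: each
vector comes from one member of a direct system, whose image in $X$ is a quotient of an object of
$\mathcal{C}$ (`Ind.exists_mem`), and $S+S'$ is a quotient of $S\oplus S'$ (`IsAdmissible.sup`).
Each axiom of an intertwining operator concerns one pair of vectors and their images under modes, so
it can be checked on some $W_1\otimes W_2$ with $W_i\in I_{X_i}$. The operators
$\phi_{W_1,W_2}\circ\mathcal{Y}_{W_1,W_2}$ are compatible with enlarging the $W_i$ and glue to
$\mathcal{Y}_{X_1,X_2}$ (`exists_hatMode`, `exists_hatOp`).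

For existence in the universal property, restrict an operator $\mathcal{Z}$ of type
$\binom{X_3}{X_1\,X_2}$ to $W_1\otimes W_2$. Although $X_3$ need not lie in $\mathcal{C}$, the image
of the restriction does, by assumption, so the restriction factors through $W_1\boxtimes W_2$
(`exists_hom_of_image`). The factors form a cocone and induce the required homomorphism
(`exists_limit_hom`).

Compatibility of that cocone and uniqueness of the homomorphism both rest on
`hom_ext_of_isAdmissible`: two homomorphisms out of $W_1\boxtimes W_2$ take values in the sum of
their images, which is an object of $\mathcal{C}$, so uniqueness inside $\mathcal{C}$ applies to any
target. -/

namespace VertexInd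

variable {V : Type u} [AddCommGroup V] [Module ℂ V] [VertexOperatorAlgebra V]
  {C : WeakModule V → Prop}

/-! ### Submodules that are objects of $\mathcal{C}$ -/

section Submodules

variable {M N P : WeakModule V}

/-- Composition of homomorphisms of weak modules. -/
def Hom.comp (g : Hom N P) (f : Hom M N) : Hom M P :=
  ⟨g.1 ∘ₗ f.1, fun n v w => by simp [f.2 n v w, g.2 n v (f.1 w)]⟩

/-- A homomorphism with values in a submodule, as a homomorphism to that submodule. -/
def Hom.codRestrict (f : Hom M N) (S : Submodule ℂ N) (hS : IsSub N S) (h : ∀ x, f.1 x ∈ S) :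
    Hom M (N.restrict S hS) :=
  ⟨f.1.codRestrict S h, fun n v w => Subtype.ext (f.2 n v w)⟩

lemma Hom.isSub_range (f : Hom M N) : IsSub N (LinearMap.range f.1) := by
  rintro n v _ ⟨x, rfl⟩
  exact ⟨M.mode n v x, f.2 n v x⟩

lemma IsSub.sup {S S' : Submodule ℂ M} (h : IsSub M S) (h' : IsSub M S') :
    IsSub M (S ⊔ S') := by
  intro n v w hw
  obtain ⟨a, ha, b, hb, rfl⟩ := Submodule.mem_sup.1 hw
  rw [map_add]
  exact Submodule.add_mem_sup (h n v a ha) (h' n v b hb)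

/-- The corestriction to the image is surjective, so closure under quotients suffices. -/
lemma IsAdmissible.range (hC : IsAdmissible C) (f : Hom M N) (hM : C M) :
    C (N.restrict (LinearMap.range f.1) (Hom.isSub_range f)) := by
  refine hC.quot M _ (Hom.codRestrict f _ (Hom.isSub_range f) fun x => ⟨x, rfl⟩) ?_ hM
  rintro ⟨_, x, rfl⟩
  exact ⟨x, rfl⟩

/-- The sum of two members of `I_M` is a member of `I_M`. -/
lemma IsAdmissible.sup (hC : IsAdmissible C) (S S' : CSub C M) :
    ∃ h : IsSub M (S.1 ⊔ S'.1), C (M.restrict (S.1 ⊔ S'.1) h) := by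
  obtain ⟨S, hS, hSC⟩ := S
  obtain ⟨S', hS', hSC'⟩ := S'
  refine ⟨hS.sup hS', ?_⟩
  -- The addition map $S\oplus S'\to M$, whose image is $S+S'$.
  let f : Hom ((M.restrict S hS).prod (M.restrict S' hS')) M :=
    ⟨S.subtype.coprod S'.subtype, fun n v w =>
      (map_add (M.mode n v) (S.subtype w.1) (S'.subtype w.2)).symm⟩
  refine hC.quot _ _ (Hom.codRestrict f (S ⊔ S') (hS.sup hS')
    fun w => Submodule.add_mem_sup w.1.2 w.2.2) ?_ (hC.sum _ _ hSC hSC')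
  rintro ⟨x, hx⟩
  obtain ⟨a, ha, b, hb, rfl⟩ := Submodule.mem_sup.1 hx
  exact ⟨(⟨a, ha⟩, ⟨b, hb⟩), rfl⟩

lemma IsAdmissible.isDirectedOrder (hC : IsAdmissible C) (X : WeakModule V) :
    IsDirectedOrder (CSub C X) :=
  ⟨fun S S' => ⟨⟨S.1 ⊔ S'.1, hC.sup S S'⟩, (le_sup_left : S.1 ≤ S.1 ⊔ S'.1),
    (le_sup_right : S'.1 ≤ S.1 ⊔ S'.1)⟩⟩

lemma IsAdmissible.nonempty (hC : IsAdmissible C) (X : WeakModule V) : Nonempty (CSub C X) :=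
  ⟨⟨⊥, fun n v w hw => by
    rw [Submodule.mem_bot] at hw
    rw [hw, map_zero]
    exact Submodule.zero_mem _, hC.zero _ (inferInstance : Subsingleton (⊥ : Submodule ℂ X))⟩⟩

/-- Every element of an object of `Ind(C)` lies in a submodule that is an object of `C`. -/
lemma Ind.exists_mem (hC : IsAdmissible C) {X : WeakModule V} (hX : Ind C X) (x : X) :
    ∃ S : CSub C X, x ∈ S.1 := by
  classical
  obtain ⟨I, _, _, _, α, f, hα, -, -, F, -, hF⟩ := hX
  obtain ⟨z, rfl⟩ := hF x
  -- Since the index set is directed and nonempty, an element of the limit comes from a single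
  -- member of the system.
  obtain ⟨i, y, rfl⟩ : ∃ i y, toLimit α f i y = z := Module.DirectLimit.exists_of z
  exact ⟨⟨_, Hom.isSub_range (Hom.comp F (limitInj α f i)), hC.range _ (hα i)⟩, y, rfl⟩

/-- Additivity of the glued operator needs both summands in one submodule. -/
lemma Ind.exists_mem₂ (hC : IsAdmissible C) {X : WeakModule V} (hX : Ind C X) (x y : X) :
    ∃ S : CSub C X, x ∈ S.1 ∧ y ∈ S.1 := by
  obtain ⟨S, hS⟩ := hX.exists_mem hC x
  obtain ⟨S', hS'⟩ := hX.exists_mem hC y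
  have := hC.isDirectedOrder X
  obtain ⟨R, h, h'⟩ := exists_ge_ge S S'
  exact ⟨R, h hS, h' hS'⟩

end Submodules

/-! ### Universal property of direct limits of weak modules -/

section Limit

variable {I : Type u} [Preorder I] {α : I → WeakModule V} {f : ∀ i j, i ≤ j → Hom (α i) (α j)}
  {X : WeakModule V}

lemma limitInj_transition {i j : I} (h : i ≤ j) (x : α i) :
    (limitInj α f j).1 ((f i j h).1 x) = (limitInj α f i).1 x := by
  classical
  exact Module.DirectLimit.of_f (f := fun i j h => (f i j h : α i →ₗ[ℂ] α j))

/-- Homomorphisms from a direct limit are determined on the members of the system. -/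
lemma limit_hom_ext {F G : Hom (directLimit α f) X}
    (h : ∀ i x, F.1 ((limitInj α f i).1 x) = G.1 ((limitInj α f i).1 x)) : F = G := by
  classical
  refine Subtype.ext (Module.DirectLimit.hom_ext fun i => LinearMap.ext fun x => h i x)

/-- The universal property of the direct limit of weak modules. -/
lemma exists_limit_hom (g : ∀ i, Hom (α i) X)
    (hg : ∀ i j (h : i ≤ j) (x : α i), (g j).1 ((f i j h).1 x) = (g i).1 x) :
    ∃ F : Hom (directLimit α f) X, ∀ i x, F.1 ((limitInj α f i).1 x) = (g i).1 x := by
  classical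
  let F : LimitSpace α f →ₗ[ℂ] X := Module.DirectLimit.lift ℂ I (fun i => α i)
    (fun i j h => (f i j h : α i →ₗ[ℂ] α j)) (fun i => (g i).1) hg
  have hF : ∀ i x, F (toLimit α f i x) = (g i).1 x := fun i x =>
    Module.DirectLimit.lift_of (f := fun i j h => (f i j h : α i →ₗ[ℂ] α j)) (fun i => (g i).1) hg x
  refine ⟨⟨F, fun n v w => ?_⟩, hF⟩
  refine limit_induction α f
    (p := fun w => F (limitMode α f n v w) = X.mode n v (F w)) (fun i x => ?_) (by simp) ?_ w
  · rw [limitMode_toLimit, hF, hF, (g i).2]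
  · intro x y hx hy
    simp only [map_add, hx, hy]

end Limit

/-! ### Intertwining operators and tensor products in $\mathcal{C}$ -/

/-- An intertwining operator with values in a submodule, as an operator to that submodule. -/
def Intertwiner.codRestrict {W₁ W₂ W₃ : WeakModule V} (Y : Intertwiner W₁ W₂ W₃)
    (S : Submodule ℂ W₃) (hS : IsSub W₃ S) (hY : ∀ h k w₁ w₂, Y.1 h k w₁ w₂ ∈ S) :
    Intertwiner W₁ W₂ (W₃.restrict S hS) :=
  ⟨fun h k => LinearMap.mk₂ ℂ (fun w₁ w₂ => (⟨Y.1 h k w₁ w₂, hY h k w₁ w₂⟩ : S))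
    (fun _ _ _ => Subtype.ext (by simp; rfl)) (fun _ _ _ => Subtype.ext (by simp; rfl))
    (fun _ _ _ => Subtype.ext (by simp; rfl)) (fun _ _ _ => Subtype.ext (by simp; rfl)), by
    refine ⟨fun w₁ w₂ h => ?_, fun w₁ w₂ h => ?_, fun v w₁ w₂ k => ?_, fun w₁ w₂ h k =>
      Subtype.ext (Y.2.2.2.2 w₁ w₂ h k)⟩
    · obtain ⟨A, hA⟩ := Y.2.1 w₁ w₂ h
      exact ⟨A, fun k hk => Subtype.ext (hA k hk)⟩
    · obtain ⟨A, hA⟩ := Y.2.2.1 w₁ w₂ h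
      exact ⟨A, fun n hn k => Subtype.ext (hA n hn k)⟩
    -- The inclusion of $S$ is injective, so the identity may be tested in $W_3$.
    · refine JacobiIdentity.comap (ι := Unit) (fun _ => S.subtype)
        (fun x y h => Subtype.ext (h ())) ?_ fun _ l m n => Y.2.2.2.1 v w₁ w₂ k l m n
      obtain ⟨h₁, h₂, h₃⟩ := Intertwiner.trunc Y v w₁ w₂ k
      refine ⟨h₁, h₂, fun h => ?_⟩
      obtain ⟨N, hN⟩ := h₃ h
      exact ⟨N, fun n hn => Subtype.ext (hN n hn)⟩⟩

namespace TensorStructure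

variable (T : TensorStructure C)

/-- The defining equation of the chosen $f_1\boxtimes f_2$, read off coefficient by coefficient. -/
lemma map_op {W₁ W₂ U₁ U₂ : {M // C M}} (f₁ : Hom W₁.1 U₁.1) (f₂ : Hom W₂.1 U₂.1) (h : ℂ) (k : ℕ)
    (w₁ : W₁.1) (w₂ : W₂.1) :
    (T.map f₁ f₂).1 ((T.op W₁ W₂).1 h k w₁ w₂) = (T.op U₁ U₂).1 h k (f₁.1 w₁) (f₂.1 w₂) := by
  have H := (((T.isTensorProduct W₁ W₂).bijective (T.obj U₁ U₂) (T.isTensorProduct U₁ U₂).mem).2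
    (precomp (T.op U₁ U₂) f₁ f₂)).choose_spec
  have H' := congrFun (congrFun (congrArg Subtype.val H) h) k
  exact LinearMap.congr_fun₂ H' w₁ w₂

/-- Homomorphisms from `W₁ ⊠ W₂` to an object of `C` are determined by their composition with
the tensor product intertwining operator. -/
lemma hom_ext {W₁ W₂ : {M // C M}} {X : WeakModule V} (hX : C X) {F G : Hom (T.obj W₁ W₂) X}
    (H : ∀ h k w₁ w₂, F.1 ((T.op W₁ W₂).1 h k w₁ w₂) = G.1 ((T.op W₁ W₂).1 h k w₁ w₂)) :
    F = G := by
  refine ((T.isTensorProduct W₁ W₂).bijective X hX).1 (Subtype.ext ?_)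
  funext h k
  exact LinearMap.ext₂ (H h k)

/-- Homomorphisms from `W₁ ⊠ W₂` to an arbitrary weak module are determined by their composition
with the tensor product intertwining operator: their images lie in an object of `C`. -/
lemma hom_ext_of_isAdmissible (hC : IsAdmissible C) {W₁ W₂ : {M // C M}} {X : WeakModule V}
    {F G : Hom (T.obj W₁ W₂) X}
    (H : ∀ h k w₁ w₂, F.1 ((T.op W₁ W₂).1 h k w₁ w₂) = G.1 ((T.op W₁ W₂).1 h k w₁ w₂)) :
    F = G := by
  have hT := (T.isTensorProduct W₁ W₂).mem
  obtain ⟨hS, hSC⟩ := hC.sup (M := X) ⟨_, Hom.isSub_range F, hC.range F hT⟩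
    ⟨_, Hom.isSub_range G, hC.range G hT⟩
  have key : Hom.codRestrict F _ hS (fun x => Submodule.mem_sup_left ⟨x, rfl⟩)
      = Hom.codRestrict G _ hS (fun x => Submodule.mem_sup_right ⟨x, rfl⟩) :=
    T.hom_ext hSC fun h k w₁ w₂ => Subtype.ext (H h k w₁ w₂)
  refine Subtype.ext (LinearMap.ext fun x => ?_)
  exact congrArg Subtype.val (LinearMap.congr_fun (congrArg Subtype.val key) x)

/-! ### Gluing the intertwining operator on $X_1\otimes X_2$ -/

variable {X₁ X₂ X₃ : WeakModule V}

lemma phi_map {W₁ U₁ : CSub C X₁} {W₂ U₂ : CSub C X₂} (h₁ : W₁ ≤ U₁) (h₂ : W₂ ≤ U₂)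
    (x : T.obj W₁.toObj W₂.toObj) :
    (T.phi U₁ U₂).1 ((T.map (CSub.inclLE h₁) (CSub.inclLE h₂)).1 x) = (T.phi W₁ W₂).1 x :=
  limitInj_transition (I := CSub C X₁ × CSub C X₂) (i := (W₁, W₂)) (j := (U₁, U₂))
    (α := fun p => T.obj p.1.toObj p.2.toObj)
    (f := fun p q (h : p ≤ q) =>
      T.map (CSub.inclLE (Prod.le_def.1 h).1) (CSub.inclLE (Prod.le_def.1 h).2))
    (Prod.le_def.2 ⟨h₁, h₂⟩) x

lemma hat_hom_ext {F G : Hom (T.hat X₁ X₂) X₃}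
    (H : ∀ (W₁ : CSub C X₁) (W₂ : CSub C X₂) x,
      F.1 ((T.phi W₁ W₂).1 x) = G.1 ((T.phi W₁ W₂).1 x)) : F = G :=
  limit_hom_ext fun i x => H i.1 i.2 x

/-- Combines the cocone relation for $\phi$ with the defining equation of the tensor product of the
inclusions. -/
lemma phi_op_of_le {W₁ U₁ : CSub C X₁} {W₂ U₂ : CSub C X₂} (h₁ : W₁ ≤ U₁) (h₂ : W₂ ≤ U₂)
    (h : ℂ) (k : ℕ) {x₁ : X₁} (hx₁ : x₁ ∈ W₁.1) {x₂ : X₂} (hx₂ : x₂ ∈ W₂.1) :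
    (T.phi U₁ U₂).1 ((T.op U₁.toObj U₂.toObj).1 h k (⟨x₁, h₁ hx₁⟩ : U₁.1) (⟨x₂, h₂ hx₂⟩ : U₂.1))
      = (T.phi W₁ W₂).1 ((T.op W₁.toObj W₂.toObj).1 h k (⟨x₁, hx₁⟩ : W₁.1) (⟨x₂, hx₂⟩ : W₂.1)) := by
  rw [← T.phi_map h₁ h₂]
  exact congrArg (T.phi U₁ U₂).1
    (T.map_op (CSub.inclLE h₁) (CSub.inclLE h₂) h k ⟨x₁, hx₁⟩ ⟨x₂, hx₂⟩).symm

/-- The vector `φ_{W₁,W₂}((x₁)_{h,k} x₂)` does not depend on the submodules `W₁ ∋ x₁` and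
`W₂ ∋ x₂`. -/
lemma phi_op_eq (hC : IsAdmissible C) {W₁ U₁ : CSub C X₁} {W₂ U₂ : CSub C X₂} (h : ℂ) (k : ℕ)
    {x₁ : X₁} (hx₁ : x₁ ∈ W₁.1) (hx₁' : x₁ ∈ U₁.1)
    {x₂ : X₂} (hx₂ : x₂ ∈ W₂.1) (hx₂' : x₂ ∈ U₂.1) :
    (T.phi W₁ W₂).1 ((T.op W₁.toObj W₂.toObj).1 h k (⟨x₁, hx₁⟩ : W₁.1) (⟨x₂, hx₂⟩ : W₂.1))
      = (T.phi U₁ U₂).1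
        ((T.op U₁.toObj U₂.toObj).1 h k (⟨x₁, hx₁'⟩ : U₁.1) (⟨x₂, hx₂'⟩ : U₂.1)) := by
  have := hC.isDirectedOrder X₁
  have := hC.isDirectedOrder X₂
  obtain ⟨R₁, a, a'⟩ := exists_ge_ge W₁ U₁
  obtain ⟨R₂, b, b'⟩ := exists_ge_ge W₂ U₂
  rw [← T.phi_op_of_le a b h k hx₁ hx₂, ← T.phi_op_of_le a' b' h k hx₁' hx₂']

/-- The coefficients of the intertwining operator of type `(X₁ ⊠̂ X₂ / X₁ X₂)`, glued from the
operators `φ_{W₁,W₂} ∘ Y_{W₁,W₂}`. -/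
lemma exists_hatMode (hC : IsAdmissible C) (hX₁ : Ind C X₁) (hX₂ : Ind C X₂) (h : ℂ) (k : ℕ) :
    ∃ B : X₁ →ₗ[ℂ] X₂ →ₗ[ℂ] T.hat X₁ X₂,
      ∀ (W₁ : CSub C X₁) (W₂ : CSub C X₂) (x₁ : W₁.1) (x₂ : W₂.1),
        B x₁ x₂ = (T.phi W₁ W₂).1 ((T.op W₁.toObj W₂.toObj).1 h k x₁ x₂) := by
  choose S₁ hS₁ using hX₁.exists_mem hC
  choose S₂ hS₂ using hX₂.exists_mem hC
  -- Any choice of submodules works, since `phi_op_eq` makes the value independent of it; each law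
  -- below is then read off with submodules suited to it.
  let b : X₁ → X₂ → T.hat X₁ X₂ := fun x₁ x₂ => (T.phi (S₁ x₁) (S₂ x₂)).1
    ((T.op _ _).1 h k (⟨x₁, hS₁ x₁⟩ : (S₁ x₁).1) (⟨x₂, hS₂ x₂⟩ : (S₂ x₂).1))
  have hb : ∀ (W₁ : CSub C X₁) (W₂ : CSub C X₂) (x₁ : W₁.1) (x₂ : W₂.1),
      b x₁ x₂ = (T.phi W₁ W₂).1 ((T.op W₁.toObj W₂.toObj).1 h k x₁ x₂) :=
    fun W₁ W₂ x₁ x₂ => T.phi_op_eq hC h k _ x₁.2 _ x₂.2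
  refine ⟨LinearMap.mk₂ ℂ b ?_ ?_ ?_ ?_, hb⟩
  · intro x y z
    obtain ⟨W₁, hx, hy⟩ := hX₁.exists_mem₂ hC x y
    have e₁ := hb W₁ (S₂ z) ⟨x, hx⟩ ⟨z, hS₂ z⟩
    have e₂ := hb W₁ (S₂ z) ⟨y, hy⟩ ⟨z, hS₂ z⟩
    -- The sum in $W_1$ coerces definitionally to $x+y$, so all three values are computed by one
    -- bilinear map.
    have e₃ := hb W₁ (S₂ z) (⟨x, hx⟩ + ⟨y, hy⟩) ⟨z, hS₂ z⟩
    exact e₃.trans ((LinearMap.map_add₂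
      (((T.op W₁.toObj (S₂ z).toObj).1 h k).compr₂ (T.phi W₁ (S₂ z)).1) _ _ _).trans
      (congrArg₂ (· + ·) e₁ e₂).symm)
  · intro c x z
    have e₁ := hb (S₁ x) (S₂ z) ⟨x, hS₁ x⟩ ⟨z, hS₂ z⟩
    have e₂ := hb (S₁ x) (S₂ z) (c • ⟨x, hS₁ x⟩) ⟨z, hS₂ z⟩
    exact e₂.trans ((LinearMap.map_smul₂
      (((T.op (S₁ x).toObj (S₂ z).toObj).1 h k).compr₂ (T.phi (S₁ x) (S₂ z)).1) _ _ _).trans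
      (congrArg (c • ·) e₁).symm)
  · intro z x y
    obtain ⟨W₂, hx, hy⟩ := hX₂.exists_mem₂ hC x y
    have e₁ := hb (S₁ z) W₂ ⟨z, hS₁ z⟩ ⟨x, hx⟩
    have e₂ := hb (S₁ z) W₂ ⟨z, hS₁ z⟩ ⟨y, hy⟩
    have e₃ := hb (S₁ z) W₂ ⟨z, hS₁ z⟩ (⟨x, hx⟩ + ⟨y, hy⟩)
    exact e₃.trans ((LinearMap.map_add
      (((T.op (S₁ z).toObj W₂.toObj).1 h k).compr₂ (T.phi (S₁ z) W₂).1 ⟨z, hS₁ z⟩) _ _).trans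
      (congrArg₂ (· + ·) e₁ e₂).symm)
  · intro c z x
    have e₁ := hb (S₁ z) (S₂ x) ⟨z, hS₁ z⟩ ⟨x, hS₂ x⟩
    have e₂ := hb (S₁ z) (S₂ x) ⟨z, hS₁ z⟩ (c • ⟨x, hS₂ x⟩)
    exact e₂.trans ((LinearMap.map_smul
      (((T.op (S₁ z).toObj (S₂ x).toObj).1 h k).compr₂ (T.phi (S₁ z) (S₂ x)).1 ⟨z, hS₁ z⟩) _ _).trans
      (congrArg (c • ·) e₁).symm)

/-- The intertwining operator of type `(X₁ ⊠̂ X₂ / X₁ X₂)`. -/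
lemma exists_hatOp (hC : IsAdmissible C) (hX₁ : Ind C X₁) (hX₂ : Ind C X₂) :
    ∃ Y : Intertwiner X₁ X₂ (T.hat X₁ X₂),
      ∀ (W₁ : CSub C X₁) (W₂ : CSub C X₂) (h : ℂ) (k : ℕ) (x₁ : W₁.1) (x₂ : W₂.1),
        Y.1 h k x₁ x₂ = (T.phi W₁ W₂).1 ((T.op W₁.toObj W₂.toObj).1 h k x₁ x₂) := by
  choose B hB using T.exists_hatMode hC hX₁ hX₂
  refine ⟨⟨B, fun x₁ x₂ h => ?_, fun x₁ x₂ h => ?_, fun v x₁ x₂ k => ?_, fun x₁ x₂ h k => ?_⟩,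
    fun W₁ W₂ h k x₁ x₂ => hB h k W₁ W₂ x₁ x₂⟩
  -- All four axioms fix $x_1$ and $x_2$, so each is transported from one $\mathcal{Y}_{W_1,W_2}$
  -- along $\phi_{W_1,W_2}$.
  all_goals
    obtain ⟨W₁, hx₁⟩ := hX₁.exists_mem hC x₁
    obtain ⟨W₂, hx₂⟩ := hX₂.exists_mem hC x₂
    lift x₁ to W₁.1 using hx₁
    lift x₂ to W₂.1 using hx₂
  · obtain ⟨A, hA⟩ := (T.op W₁.toObj W₂.toObj).2.1 x₁ x₂ h
    exact ⟨A, fun k hk => by rw [hB, hA k hk, map_zero]⟩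
  · obtain ⟨A, hA⟩ := (T.op W₁.toObj W₂.toObj).2.2.1 x₁ x₂ h
    exact ⟨A, fun n hn k => by rw [hB, hA n hn k, map_zero]⟩
  · refine ((T.op W₁.toObj W₂.toObj).2.2.2.1 v x₁ x₂ k).map (T.phi W₁ W₂).1 (fun h n => ?_)
      (fun h n => ?_) (fun h n => ?_) (Intertwiner.trunc _ v _ _ k)
    -- Submodules are stable under modes, so the same pair $(W_1,W_2)$ still computes the value
    -- after $v_n$ is applied to an argument.
    · exact hB h k W₁ W₂ x₁ ⟨X₂.mode n v x₂, W₂.2.fst n v _ x₂.2⟩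
    · exact hB h k W₁ W₂ ⟨X₁.mode n v x₁, W₁.2.fst n v _ x₁.2⟩ x₂
    · rw [hB, (T.phi W₁ W₂).2]
  · have e := hB h k W₁ W₂ ⟨X₁.L (-1) x₁, W₁.2.fst _ _ _ x₁.2⟩ x₂
    rw [hB, hB, ← map_smul, ← map_smul, ← map_add]
    exact e.trans (congrArg _ ((T.op W₁.toObj W₂.toObj).2.2.2.2 x₁ x₂ h k))

/-! ### Membership in $\mathrm{Ind}(\mathcal{C})$ and factorization through $W_1\boxtimes W_2$ -/

/-- `X₁ ⊠̂ X₂` is an object of `Ind(C)`. -/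
lemma hat_ind (hC : IsAdmissible C) (X₁ X₂ : WeakModule V) : Ind C (T.hat X₁ X₂) := by
  have := hC.isDirectedOrder X₁
  have := hC.isDirectedOrder X₂
  have := hC.nonempty X₁
  have := hC.nonempty X₂
  refine ⟨CSub C X₁ × CSub C X₂, inferInstance, inferInstance, ⟨fun p q => ?_⟩,
    fun p => T.obj p.1.toObj p.2.toObj, fun p q h =>
      T.map (CSub.inclLE (Prod.le_def.1 h).1) (CSub.inclLE (Prod.le_def.1 h).2),
    fun p => (T.isTensorProduct _ _).mem, fun p => ?_, fun p q r hpq hqr => ?_,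
    ⟨LinearMap.id, fun _ _ _ => rfl⟩, Function.bijective_id⟩
  · obtain ⟨a, ha⟩ := exists_ge_ge p.1 q.1
    obtain ⟨b, hb⟩ := exists_ge_ge p.2 q.2
    exact ⟨(a, b), ⟨ha.1, hb.1⟩, ⟨ha.2, hb.2⟩⟩
  -- Functoriality of $\boxtimes$ on inclusions follows from uniqueness: both sides have the same
  -- composite with the tensor product operator. The composition law below is argued likewise.
  · refine congrArg Subtype.val (T.hom_ext (T.isTensorProduct _ _).mem
      (G := ⟨LinearMap.id, fun _ _ _ => rfl⟩) fun h k w₁ w₂ => ?_)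
    rw [map_op]
    rfl
  · refine congrArg Subtype.val (T.hom_ext (T.isTensorProduct _ _).mem
      (F := Hom.comp (T.map _ _) (T.map _ _)) fun h k w₁ w₂ => ?_)
    refine Eq.trans (congrArg (T.map (CSub.inclLE (Prod.le_def.1 hqr).1)
      (CSub.inclLE (Prod.le_def.1 hqr).2)).1 (T.map_op _ _ h k w₁ w₂)) ?_
    rw [map_op, map_op]
    rfl

/-- An intertwining operator among objects of `C` whose image is an object of `C` factors through
the tensor product. -/
lemma exists_hom_of_image {W₁ W₂ : {M // C M}} (Y : Intertwiner W₁.1 W₂.1 X₃)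
    (hY : C (imageModule Y)) :
    ∃ g : Hom (T.obj W₁ W₂) X₃,
      ∀ h k w₁ w₂, g.1 ((T.op W₁ W₂).1 h k w₁ w₂) = Y.1 h k w₁ w₂ := by
  -- The universal property in $\mathcal{C}$ is applied with target $\mathrm{im}\,\mathcal{Y}$
  -- rather than $X_3$.
  obtain ⟨g, hg⟩ := ((T.isTensorProduct W₁ W₂).bijective _ hY).2
    (Intertwiner.codRestrict Y (image Y) (image_isSub Y)
      fun h k w₁ w₂ => Submodule.subset_span ⟨h, k, w₁, w₂, rfl⟩)
  refine ⟨⟨(image Y).subtype ∘ₗ g.1, fun n v w => congrArg Subtype.val (g.2 n v w)⟩,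
    fun h k w₁ w₂ => ?_⟩
  have H := LinearMap.congr_fun₂ (congrFun (congrFun (congrArg Subtype.val hg) h) k) w₁ w₂
  exact congrArg Subtype.val H

end TensorStructure

end VertexInd

/-! ### The universal property of $X_1\widehat{\boxtimes}X_2$ -/

theorem theorem6p1 {V : Type u} [AddCommGroup V] [Module ℂ V] [VertexOperatorAlgebra V]
    (C : WeakModule V → Prop) (hC : IsAdmissible C) (hV : C (adjoint V))
    (T : TensorStructure C)
    (him : ∀ (W₁ W₂ X : WeakModule V), C W₁ → C W₂ → Ind C X →
      ∀ Y : Intertwiner W₁ W₂ X, C (imageModule Y))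
    (X₁ X₂ : WeakModule V) (hX₁ : Ind C X₁) (hX₂ : Ind C X₂) :
    ∃ Y : Intertwiner X₁ X₂ (T.hat X₁ X₂),
      (∀ (W₁ : CSub C X₁) (W₂ : CSub C X₂),
        precomp Y W₁.incl W₂.incl
          = compIntertwiner (T.op W₁.toObj W₂.toObj) (T.hat X₁ X₂) (T.phi W₁ W₂)) ∧
      IsIntertwiningTensorProduct (Ind C) Y := by
  obtain ⟨Y, hY⟩ := T.exists_hatOp hC hX₁ hX₂
  refine ⟨Y, fun W₁ W₂ => ?_, T.hat_ind hC X₁ X₂, fun X₃ hX₃ => ⟨fun F G hFG => ?_, fun Z => ?_⟩⟩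
  · refine Subtype.ext (funext fun h => funext fun k => LinearMap.ext₂ fun w₁ w₂ => ?_)
    exact hY W₁ W₂ h k w₁ w₂
  · refine T.hat_hom_ext fun W₁ W₂ x => ?_
    -- On each $W_1\boxtimes W_2$ the two homomorphisms agree on the coefficients of
    -- $\mathcal{Y}_{W_1,W_2}$, because there $\mathcal{Y}_{X_1,X_2}$ is
    -- $\phi_{W_1,W_2}\circ\mathcal{Y}_{W_1,W_2}$.
    have key : Hom.comp F (T.phi W₁ W₂) = Hom.comp G (T.phi W₁ W₂) := by
      refine T.hom_ext_of_isAdmissible hC fun h k w₁ w₂ => ?_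
      have e := hY W₁ W₂ h k w₁ w₂
      refine (congrArg F.1 e).symm.trans (Eq.trans ?_ (congrArg G.1 e))
      exact LinearMap.congr_fun₂ (congrFun (congrFun (congrArg Subtype.val hFG) h) k) _ _
    exact LinearMap.congr_fun (congrArg Subtype.val key) x
  -- The assumption on images enters here, for the restriction of $\mathcal{Z}$ to each $W_1\otimes
  -- W_2$.
  · choose g hg using fun p : CSub C X₁ × CSub C X₂ =>
      T.exists_hom_of_image (precomp Z p.1.incl p.2.incl)
        (him _ _ X₃ p.1.toObj.2 p.2.toObj.2 hX₃ _)
    obtain ⟨F, hF⟩ := exists_limit_hom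
      (f := fun p q (h : p ≤ q) =>
        T.map (CSub.inclLE (Prod.le_def.1 h).1) (CSub.inclLE (Prod.le_def.1 h).2)) g
      (fun p q hpq x => by
        -- Both sides, composed with the tensor product operator at `p`, give the restriction of
        -- $\mathcal{Z}$ to the smaller pair.
        have key : Hom.comp (g q) (T.map (CSub.inclLE (Prod.le_def.1 hpq).1)
            (CSub.inclLE (Prod.le_def.1 hpq).2)) = g p := by
          refine T.hom_ext_of_isAdmissible hC fun h k w₁ w₂ => ?_
          refine (congrArg (g q).1 (T.map_op _ _ h k w₁ w₂)).trans ?_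
          rw [hg, hg]
          rfl
        exact LinearMap.congr_fun (congrArg Subtype.val key) x)
    refine ⟨F, Subtype.ext (funext fun h => funext fun k => LinearMap.ext₂ fun x₁ x₂ => ?_)⟩
    obtain ⟨W₁, hx₁⟩ := hX₁.exists_mem hC x₁
    obtain ⟨W₂, hx₂⟩ := hX₂.exists_mem hC x₂
    refine (congrArg F.1 (hY W₁ W₂ h k ⟨x₁, hx₁⟩ ⟨x₂, hx₂⟩)).trans ?_
    refine (hF (W₁, W₂) _).trans ?_
    exact hg (W₁, W₂) h k _ _
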